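/- Let $d\ge 2$. A convex body in $\mathbb{E}^d$ is a compact convex set with non-empty interior. For a convex body $\mathbf{A}$ and a hyperplane $H$ of $\mathbb{E}^d$, let $w(\mathbf{A},H)$ be the distance between the two supporting hyperplanes of $\mathbf{A}$ parallel to $H$. For convex bodies $\mathbf{A},\mathbf{C}$ the minimal $\mathbf{C}$-width of $\mathbf{A}$ is $$w_{\mathbf{C}}(\mathbf{A})=\min_H \frac{w(\mathbf{A},H)}{w(\mathbf{C},H)},$$ where the minimum is taken over all hyperplanes $H$ of $\mathbb{E}^d$. A convex partition of $\mathbb{E}^d$ is a finite family $\mathbf{V}_1,\dots,\mathbf{V}_n$ $(n\ge 1)$ of closed convex sets with pairwise disjoint non-empty interiors and $\mathbf{V}_1\cup\dots\cup\mathbf{V}_n=\mathbb{E}^d$. Inductive partitions are defined recursively in $n$: the partition into one part $\mathbf{V}_1=\mathbb{E}^d$ is inductive; for $n\ge 2$, a convex partition $\mathbf{V}_1\cup\dots\cup\mathbf{V}_n$ is inductive if for every $1\le i\le n$ there is an inductive partition $\mathbf{W}_1\cup\dots\cup\mathbf{W}_{i-1}\cup\mathbf{W}_{i+1}\cup\dots\cup\mathbf{W}_n$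 of $\mathbb{E}^d$ such that $\mathbf{V}_j\subset\mathbf{W}_j$ for all $j\ne i$. Corollary 2.3. Let $\mathbf{K}$ and $\mathbf{C}$ be convex bodies in $\mathbb{E}^d$, $d\ge 2$. If $\mathbf{V}_1\cup\dots\cup\mathbf{V}_n$ is an inductive partition of $\mathbb{E}^d$ such that ${\rm int}(\mathbf{V}_i\cap\mathbf{K})\ne\emptyset$ for all $1\le i\le n$, then $$\sum_{i=1}^n w_{\mathbf{C}}(\mathbf{V}_i\cap\mathbf{K})\ge w_{\mathbf{C}}(\mathbf{K}).$$ -/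

import Mathlib

/-- A convex partition of a space: finitely many closed convex sets with pairwise disjoint,
non-empty interiors whose union is the whole space. -/
structure IsConvexPartition {d n : ℕ} (V : Fin n → Set (EuclideanSpace ℝ (Fin d))) : Prop where
  isClosed : ∀ i, IsClosed (V i)
  convex : ∀ i, Convex ℝ (V i)
  interior_nonempty : ∀ i, (interior (V i)).Nonempty
  interior_disjoint : ∀ i j, i ≠ j → Disjoint (interior (V i)) (interior (V j))
  iUnion_eq : ⋃ i, V i = Set.univ

/-- Inductive partitions, by recursion on the number of parts. The one-part partition is inductive;
a convex partition into at least two parts is inductive if for every index `i` there is an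
inductive partition `W`, indexed by the remaining indices, with `V j ⊆ W j` for all `j ≠ i`.
The remaining indices are enumerated increasingly by `i.succAbove`. -/
def IsInductivePartition {d : ℕ} : {n : ℕ} → (Fin n → Set (EuclideanSpace ℝ (Fin d))) → Prop
  | 0, _ => False
  | 1, V => V 0 = Set.univ
  | n + 2, V => IsConvexPartition V ∧
      ∀ i : Fin (n + 2), ∃ W : Fin (n + 1) → Set (EuclideanSpace ℝ (Fin d)),
        IsInductivePartition W ∧ ∀ j : Fin (n + 1), V (i.succAbove j) ⊆ W j

/-- The width of `A` parallel to the hyperplanes with unit normal vector `u`: the distance between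
the two supporting hyperplanes `{x | ⟪u, x⟫ = sup over A}` and `{x | ⟪u, x⟫ = inf over A}`.
It is meant for unit vectors `u` and non-empty bounded sets `A`. -/
noncomputable def widthParallel {d : ℕ} (A : Set (EuclideanSpace ℝ (Fin d)))
    (u : EuclideanSpace ℝ (Fin d)) : ℝ :=
  sSup ((fun x => inner ℝ u x) '' A) - sInf ((fun x => inner ℝ u x) '' A)

/-- The minimal `C`-width of `A`: the least value of `w(A, H) / w(C, H)` over all
hyperplanes `H`, each direction of hyperplanes being given by a unit normal vector. -/
noncomputable def minimalRelativeWidth {d : ℕ} (C A : Set (EuclideanSpace ℝ (Fin d))) : ℝ :=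
  ⨅ u : Metric.sphere (0 : EuclideanSpace ℝ (Fin d)) 1, widthParallel A u / widthParallel C u

/-! For a convex body B let h_i(y) be the supremum of the ratios of homothetic copies of B inside
V_i ∩ (y + B). The key claim is ∑ h_i(y) ≥ 1 for every y, by induction on the number of parts. If
the interior of y + B misses the interior of some V_i, that part can be dropped: the induction
hypothesis holds for W, and copies in W_j ∩ (y + B) already lie in V_j
(`IsConvexPartition.sSup_homothetyRatios_le`). All other y are interior to the closed, convex,
proper set D of those y for which y + B meets every part. On D the sum is concave, and it is at
least 1 on the boundary, hence on all of D (`ConcaveOn.one_le_of_one_le_frontier`). With B = K and y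
= 0, a copy of K of ratio r in V_i ∩ K forces w_C(V_i ∩ K) ≥ r w_C(K); summing over i finishes the
proof. -/

open Set Topology
open scoped Pointwise

/-! ### Concave functions bounded below on the boundary -/

/-- A nonnegative concave function on a proper closed subset that is at least `1` at every
non-interior point is at least `1` everywhere on the set. -/
theorem ConcaveOn.one_le_of_one_le_frontier {E : Type*} [NormedAddCommGroup E] [NormedSpace ℝ E]
    {D : Set E} {F : E → ℝ} (hD : IsClosed D) (hne : D ≠ univ) (hF : ConcaveOn ℝ D F)
    (h0 : ∀ y, 0 ≤ F y) (h1 : ∀ y ∈ D, y ∉ interior D → 1 ≤ F y) {y : E} (hy : y ∈ D) :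
    1 ≤ F y := by
  have exit : ∀ v : E, y + v ∉ D → ∃ b : ℝ, 0 ≤ b ∧ y + b • v ∈ D ∧ 1 ≤ F (y + b • v) := by
    intro v hv
    have hg : Continuous fun t : ℝ => y + t • v := by fun_prop
    have hcpt : IsCompact (Icc (0 : ℝ) 1 ∩ (fun t : ℝ => y + t • v) ⁻¹' D) :=
      isCompact_Icc.inter_right (hD.preimage hg)
    -- The last parameter for which the segment is in `D`; at an interior point of `D` it could
    -- still be increased.
    obtain ⟨b, ⟨hb01, hbD⟩, hbmax⟩ := hcpt.exists_isGreatest ⟨0, by simp, by simpa using hy⟩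
    refine ⟨b, hb01.1, hbD, h1 _ hbD fun hint => ?_⟩
    have hb1 : b < 1 := by
      rcases hb01.2.lt_or_eq with h | h
      · exact h
      · subst h
        simp only [mem_preimage, one_smul] at hbD
        exact absurd hbD hv
    have hev : ∀ᶠ t in 𝓝[>] b, y + t • v ∈ interior D :=
      (hg.continuousAt.eventually_mem (isOpen_interior.mem_nhds hint)).filter_mono
        nhdsWithin_le_nhds
    obtain ⟨t, ht, htI⟩ := (hev.and (Ioo_mem_nhdsGT hb1)).exists
    have := hbmax ⟨⟨hb01.1.trans htI.1.le, htI.2.le⟩, (interior_subset ht : y + t • v ∈ D)⟩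
    exact absurd htI.1 (not_lt.mpr this)
  obtain ⟨y₁, hy₁⟩ := (ne_univ_iff_exists_notMem D).mp hne
  set v := y₁ - y with hv
  obtain ⟨b, hb, hbD, hb1⟩ := exit v (by simpa [hv] using hy₁)
  rcases hb.eq_or_lt with rfl | hb
  · simpa using hb1
  have comb : ∀ c : ℝ, 0 ≤ c → y + (-c) • v ∈ D →
      c * F (y + b • v) + b * F (y + (-c) • v) ≤ (b + c) * F y := by
    intro c hc hcD
    have hbc : 0 < b + c := by linarith
    have key := hF.2 hbD hcD (show 0 ≤ c / (b + c) by positivity)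
      (show 0 ≤ b / (b + c) by positivity)
      (by field_simp; ring)
    have e : (c / (b + c)) • (y + b • v) + (b / (b + c)) • (y + (-c) • v) = y := by
      match_scalars <;> field_simp <;> ring
    rw [e, smul_eq_mul, smul_eq_mul] at key
    have := mul_le_mul_of_nonneg_left key hbc.le
    refine le_trans (le_of_eq ?_) this
    field_simp
  by_cases hall : ∀ c : ℝ, 0 ≤ c → y + (-c) • v ∈ D
  · by_contra! hlt
    have hpos : 0 < 1 - F y := by linarith
    -- With `F ≥ 1` at the forward exit point and `F ≥ 0` backward, `comb` gives `c * (1 - F y) ≤ b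
    -- * F y`; this `c` violates it by exactly 1.
    set c := (b * F y + 1) / (1 - F y) with hc
    have hc0 : 0 ≤ c := div_nonneg (by have := h0 y; positivity) hpos.le
    have h := comb c hc0 (hall c hc0)
    have hceq : c * (1 - F y) = b * F y + 1 := by rw [hc]; field_simp
    have := mul_nonneg hb.le (h0 (y + (-c) • v))
    have := mul_le_mul_of_nonneg_left hb1 hc0
    linarith
  · push Not at hall
    obtain ⟨c, hc, hcD⟩ := hall
    obtain ⟨s, hs, hsD, hs1⟩ := exit ((-c) • v) hcD
    have e : s • (-c) • v = (-(s * c)) • v := by rw [smul_smul]; congr 1; ring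
    rw [e] at hsD hs1
    have hsc : 0 ≤ s * c := mul_nonneg hs hc
    have h := comb (s * c) hsc hsD
    have := mul_le_mul_of_nonneg_left hb1 hsc
    have := mul_le_mul_of_nonneg_left hs1 hb.le
    have hpos : 0 < b + s * c := by linarith
    exact le_of_mul_le_mul_left (by linarith) hpos

/-! ### Translates of a compact set meeting a closed set -/

/-- A closed convex proper subset misses some translate of a given bounded set. -/
theorem exists_translate_disjoint {E : Type*} [NormedAddCommGroup E] [NormedSpace ℝ E]
    {V B : Set E} (hVc : IsClosed V) (hV : Convex ℝ V) (hne : V ≠ univ) (hB : IsCompact B) :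
    ∃ y, ∀ z ∈ V, z - y ∉ B := by
  obtain ⟨x, hx⟩ := (ne_univ_iff_exists_notMem V).mp hne
  rcases V.eq_empty_or_nonempty with rfl | ⟨a, ha⟩
  · exact ⟨0, by simp⟩
  obtain ⟨f, u, hfu, hux⟩ := geometric_hahn_banach_closed_point hV hVc hx
  obtain ⟨m, hm⟩ := (hB.image f.continuous).bddBelow
  have hpos : 0 < f x - f a := by linarith [hfu a ha]
  -- This translation vector has `f`-value `u - m`, so `f ≥ u` on the translate of `B`, whereas `f <
  -- u` on `V`.
  refine ⟨((u - m) / (f x - f a)) • (x - a), fun z hz hzB => ?_⟩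
  have h1 := hm (mem_image_of_mem f hzB)
  have h2 : (u - m) / (f x - f a) * (f x - f a) = u - m := by field_simp
  simp only [map_sub, map_smul, smul_eq_mul, h2] at h1
  linarith [hfu z hz]

theorem isClosed_translates_meeting {E : Type*} [NormedAddCommGroup E] {B V : Set E}
    (hV : IsClosed V) (hB : IsCompact B) :
    IsClosed {y | ∃ z ∈ V, z - y ∈ B} := by
  have h : {y | ∃ z ∈ V, z - y ∈ B} = V + (-B) := by
    ext y
    simp only [mem_ofPred_eq, Set.mem_add, Set.mem_neg]
    constructor
    · rintro ⟨z, hz, hzy⟩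
      exact ⟨z, hz, y - z, by simpa using hzy, by abel⟩
    · rintro ⟨z, hz, w, hw, rfl⟩
      exact ⟨z, hz, by simpa using hw⟩
  rw [h]
  exact hV.add_right_of_isCompact hB.neg

/-! ### Ratios of homothetic copies -/

/-- The ratios in `[0, 1]` of the homothetic copies of `B` contained in `V ∩ (y + B)`. -/
def homothetyRatios {E : Type*} [NormedAddCommGroup E] [NormedSpace ℝ E] (B V : Set E) (y : E) :
    Set ℝ :=
  {h | 0 ≤ h ∧ h ≤ 1 ∧ ∃ x, ∀ b ∈ B, x + h • b ∈ V ∧ x + h • b - y ∈ B}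

section HomothetyRatios

variable {E : Type*} [NormedAddCommGroup E] [NormedSpace ℝ E] {B V : Set E} {y : E}

theorem bddAbove_homothetyRatios : BddAbove (homothetyRatios B V y) := ⟨1, fun _ h => h.2.1⟩

theorem sSup_homothetyRatios_nonneg : 0 ≤ sSup (homothetyRatios B V y) :=
  Real.sSup_nonneg fun _ h => h.1

theorem zero_mem_homothetyRatios {z : E} (hz : z ∈ V) (hzy : z - y ∈ B) :
    0 ∈ homothetyRatios B V y :=
  ⟨le_rfl, zero_le_one, z, fun b _ => by simpa using ⟨hz, hzy⟩⟩

/-- Copies of ratios h and k in the sets for p and q average to a copy of ratio s h + t k in the set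
for s p + t q. On the stated domain, ratio 0 keeps every set of ratios nonempty, so the suprema can
be approximated. -/
theorem concaveOn_sSup_homothetyRatios (hV : Convex ℝ V) (hB : Convex ℝ B) :
    ConcaveOn ℝ {y | ∃ z ∈ V, z - y ∈ B} fun y => sSup (homothetyRatios B V y) := by
  refine ⟨?_, ?_⟩
  · rintro p ⟨z, hz, hzp⟩ q ⟨w, hw, hwq⟩ s t hs ht hst
    refine ⟨s • z + t • w, hV hz hw hs ht hst, ?_⟩
    convert hB hzp hwq hs ht hst using 1
    module
  · rintro p ⟨z, hz, hzp⟩ q ⟨w, hw, hwq⟩ s t hs ht hst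
    have h0p := zero_mem_homothetyRatios hz hzp
    have h0q := zero_mem_homothetyRatios hw hwq
    have key : ∀ h ∈ homothetyRatios B V p, ∀ k ∈ homothetyRatios B V q,
        s * h + t * k ≤ sSup (homothetyRatios B V (s • p + t • q)) := by
      rintro h ⟨hh0, hh1, x, hx⟩ k ⟨hk0, hk1, x', hx'⟩
      refine le_csSup bddAbove_homothetyRatios ⟨by positivity, ?_, s • x + t • x', fun b hb => ?_⟩
      · have := mul_le_mul_of_nonneg_left hh1 hs
        have := mul_le_mul_of_nonneg_left hk1 ht
        linarith
      · constructor
        · convert hV (hx b hb).1 (hx' b hb).1 hs ht hst using 1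
          module
        · convert hB (hx b hb).2 (hx' b hb).2 hs ht hst using 1
          module
    have approx : ∀ ε > 0, s * sSup (homothetyRatios B V p) + t * sSup (homothetyRatios B V q) ≤
        sSup (homothetyRatios B V (s • p + t • q)) + ε := by
      intro ε hε
      obtain ⟨h, hh, hlt⟩ := exists_lt_of_lt_csSup ⟨0, h0p⟩ (sub_lt_self _ hε)
      obtain ⟨k, hk, hlt'⟩ := exists_lt_of_lt_csSup ⟨0, h0q⟩ (sub_lt_self _ hε)
      have e1 := mul_le_mul_of_nonneg_left hlt.le hs
      have e2 := mul_le_mul_of_nonneg_left hlt'.le ht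
      have e3 : s * ε + t * ε = ε := by rw [← add_mul, hst, one_mul]
      linarith [key h hh k hk]
    simpa only [smul_eq_mul] using le_of_forall_pos_le_add approx

end HomothetyRatios

/-! ### Homothetic copies in the parts of an inductive partition -/

section Partition

variable {d : ℕ}

theorem IsInductivePartition.isConvexPartition {n : ℕ}
    {V : Fin n → Set (EuclideanSpace ℝ (Fin d))} (hV : IsInductivePartition V) :
    IsConvexPartition V := by
  match n, V, hV with
  | 1, V, hV =>
    have h : ∀ i, V i = univ := fun i => by rw [Subsingleton.elim i 0]; exact hV
    exact
      { isClosed := fun i => by rw [h]; exact isClosed_univ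
        convex := fun i => by rw [h]; exact convex_univ
        interior_nonempty := fun i => by rw [h, interior_univ]; exact univ_nonempty
        interior_disjoint := fun i j hij => absurd (Subsingleton.elim i j) hij
        iUnion_eq := eq_univ_of_subset (subset_iUnion V 0) hV }
  | n + 2, V, hV => exact hV.1

/-- Deleting a part that does not meet the interior of `y + B` does not enlarge the homothetic
copies of `B` in the other parts. -/
theorem IsConvexPartition.sSup_homothetyRatios_le {n : ℕ}
    {V : Fin (n + 1) → Set (EuclideanSpace ℝ (Fin d))} {W : Fin n → Set (EuclideanSpace ℝ (Fin d))}
    (hV : IsConvexPartition V) (hW : IsConvexPartition W) {i : Fin (n + 1)}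
    (hVW : ∀ j, V (i.succAbove j) ⊆ W j) {B : Set (EuclideanSpace ℝ (Fin d))} (hB : Convex ℝ B)
    (hBi : (interior B).Nonempty) {y : EuclideanSpace ℝ (Fin d)}
    (hi : ∀ z ∈ interior (V i), z - y ∉ interior B) (j : Fin n) :
    sSup (homothetyRatios B (W j) y) ≤ sSup (homothetyRatios B (V (i.succAbove j)) y) := by
  refine Real.sSup_le ?_ sSup_homothetyRatios_nonneg
  rintro h ⟨h0, h1, x, hx⟩
  rcases h0.eq_or_lt with rfl | hpos
  · exact sSup_homothetyRatios_nonneg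
  have hhom : IsOpenMap fun b : EuclideanSpace ℝ (Fin d) => x + h • b :=
    (isOpenMap_add_left x).comp (isOpenMap_smul₀ hpos.ne')
  have hcont : Continuous fun b : EuclideanSpace ℝ (Fin d) => x + h • b := by fun_prop
  have hO : IsOpen ((fun b => x + h • b) '' interior B) := hhom _ isOpen_interior
  have hOW : (fun b => x + h • b) '' interior B ⊆ interior (W j) :=
    interior_maximal (by rintro _ ⟨b, hb, rfl⟩; exact (hx b (interior_subset hb)).1) hO
  have hOB : (fun b => x + h • b) '' interior B ⊆ (fun z => z - y) ⁻¹' interior B := by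
    have : (fun b => x + h • b) '' interior B ⊆ interior ((fun z => z - y) ⁻¹' B) :=
      interior_maximal (by rintro _ ⟨b, hb, rfl⟩; exact (hx b (interior_subset hb)).2) hO
    exact this.trans ((Homeomorph.subRight y).preimage_interior B).ge
  -- Near a point of the open copy outside V_j there would be interior points of another part, still
  -- inside the copy. That part is not V_i, by `hi`; any other lies in some W_l, whose interior is
  -- disjoint from that of W_j.
  have hOV : (fun b => x + h • b) '' interior B ⊆ V (i.succAbove j) := by
    intro z hz
    by_contra hzV
    set O := (fun b => x + h • b) '' interior B ∩ (V (i.succAbove j))ᶜ with hOdef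
    have hOo : IsOpen O := hO.inter (hV.isClosed _).isOpen_compl
    have hzO : z ∈ O := ⟨hz, hzV⟩
    obtain ⟨k, hk⟩ := mem_iUnion.mp (hV.iUnion_eq ▸ mem_univ z : z ∈ ⋃ k, V k)
    have hcl : z ∈ closure (interior (V k)) := by
      rw [(hV.convex k).closure_interior_eq_closure_of_nonempty_interior (hV.interior_nonempty k)]
      exact subset_closure hk
    obtain ⟨p, hpO, hpk⟩ := mem_closure_iff.mp hcl O hOo hzO
    rcases Fin.eq_self_or_eq_succAbove i k with rfl | ⟨l, rfl⟩
    · exact hi p hpk (hOB hpO.1)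
    · by_cases hl : l = j
      · subst hl
        exact hpO.2 (interior_subset hpk)
      · exact disjoint_left.mp (hW.interior_disjoint l j hl)
          (interior_mono (hVW l) hpk) (hOW hpO.1)
  refine le_csSup bddAbove_homothetyRatios ⟨h0, h1, x, fun b hb => ⟨?_, (hx b hb).2⟩⟩
  have hbcl : b ∈ closure (interior B) := by
    rw [hB.closure_interior_eq_closure_of_nonempty_interior hBi]
    exact subset_closure hb
  exact closure_minimal hOV (hV.isClosed _)
    (image_closure_subset_closure_image hcont (mem_image_of_mem _ hbcl))

/-- The parts of an inductive partition contain, inside every translate of a convex body `B`,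
homothetic copies of `B` whose ratios have sum at least `1`. -/
theorem IsInductivePartition.one_le_sum_sSup_homothetyRatios
    {B : Set (EuclideanSpace ℝ (Fin d))} (hBc : IsCompact B) (hB : Convex ℝ B)
    (hBi : (interior B).Nonempty) {n : ℕ} {V : Fin n → Set (EuclideanSpace ℝ (Fin d))}
    (hV : IsInductivePartition V) (y : EuclideanSpace ℝ (Fin d)) :
    1 ≤ ∑ i, sSup (homothetyRatios B (V i) y) := by
  induction n generalizing y with
  | zero => exact hV.elim
  | succ n ih =>
    cases n with
    | zero =>
      have h0 : V 0 = univ := hV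
      rw [Fin.sum_univ_one]
      exact le_csSup bddAbove_homothetyRatios
        ⟨zero_le_one, le_rfl, y, fun b hb => by simpa [h0] using hb⟩
    | succ n =>
      have hP := hV.isConvexPartition
      have drop : ∀ y, (∃ i, ∀ z ∈ interior (V i), z - y ∉ interior B) →
          1 ≤ ∑ i, sSup (homothetyRatios B (V i) y) := by
        rintro y ⟨i, hi⟩
        obtain ⟨W, hW, hVW⟩ := hV.2 i
        rw [Fin.sum_univ_succAbove _ i]
        calc (1 : ℝ) ≤ ∑ j, sSup (homothetyRatios B (W j) y) := ih hW y
          _ ≤ ∑ j, sSup (homothetyRatios B (V (i.succAbove j)) y) :=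
            Finset.sum_le_sum fun j _ =>
              hP.sSup_homothetyRatios_le hW.isConvexPartition hVW hB hBi hi j
          _ ≤ _ := le_add_of_nonneg_left sSup_homothetyRatios_nonneg
      by_cases hy : ∃ i, ∀ z ∈ interior (V i), z - y ∉ interior B
      · exact drop y hy
      set D := ⋂ i, {y | ∃ z ∈ V i, z - y ∈ B} with hD
      -- Finitely many open conditions: hence `drop` covers every non-interior point of `D`.
      have mem_interior : ∀ y, (¬ ∃ i, ∀ z ∈ interior (V i), z - y ∉ interior B) →
          y ∈ interior D := by
        intro y hy
        push Not at hy
        choose z hz hzy using hy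
        rw [mem_interior_iff_mem_nhds, hD, Filter.iInter_mem]
        intro i
        have hc : ContinuousAt (fun y => z i - y) y := by fun_prop
        filter_upwards [hc.eventually_mem (isOpen_interior.mem_nhds (hzy i))] with w hw
        exact ⟨z i, interior_subset (hz i), interior_subset hw⟩
      have hDc : IsClosed D :=
        isClosed_iInter fun i => isClosed_translates_meeting (hP.isClosed i) hBc
      have hDconv : Convex ℝ D :=
        convex_iInter fun i => (concaveOn_sSup_homothetyRatios (hP.convex i) hB).1
      have hV0 : V 0 ≠ univ := by
        intro h
        have := hP.interior_disjoint 0 1 (by simp)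
        rw [h, interior_univ, univ_disjoint] at this
        exact (hP.interior_nonempty 1).ne_empty this
      have hDne : D ≠ univ := by
        obtain ⟨w, hw⟩ := exists_translate_disjoint (hP.isClosed 0) (hP.convex 0) hV0 hBc
        refine (ne_univ_iff_exists_notMem D).mpr ⟨w, fun hwD => ?_⟩
        obtain ⟨z, hz, hzw⟩ := mem_iInter.mp hwD 0
        exact hw z hz hzw
      have hconc : ConcaveOn ℝ D fun y => ∑ i, sSup (homothetyRatios B (V i) y) := by
        refine ⟨hDconv, fun p hp q hq s t hs ht hst => ?_⟩
        simp only [smul_eq_mul, Finset.mul_sum, ← Finset.sum_add_distrib]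
        exact Finset.sum_le_sum fun i _ =>
          (concaveOn_sSup_homothetyRatios (hP.convex i) hB).2
            (mem_iInter.mp hp i) (mem_iInter.mp hq i) hs ht hst
      refine hconc.one_le_of_one_le_frontier hDc hDne
        (fun y => Finset.sum_nonneg fun i _ => sSup_homothetyRatios_nonneg)
        (fun y _ hyI => drop y ?_) (interior_subset (mem_interior y hy))
      by_contra h
      exact hyI (mem_interior y h)

end Partition

/-! ### Monotonicity and homogeneity of relative width -/

section Width

variable {d : ℕ}

theorem bddAbove_inner_image {A : Set (EuclideanSpace ℝ (Fin d))} (hA : IsCompact A)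
    (u : EuclideanSpace ℝ (Fin d)) : BddAbove ((fun x => inner ℝ u x) '' A) :=
  (hA.image (by fun_prop)).bddAbove

theorem bddBelow_inner_image {A : Set (EuclideanSpace ℝ (Fin d))} (hA : IsCompact A)
    (u : EuclideanSpace ℝ (Fin d)) : BddBelow ((fun x => inner ℝ u x) '' A) :=
  (hA.image (by fun_prop)).bddBelow

theorem widthParallel_nonneg {A : Set (EuclideanSpace ℝ (Fin d))} (hA : IsCompact A)
    (u : EuclideanSpace ℝ (Fin d)) : 0 ≤ widthParallel A u :=
  sub_nonneg.mpr (Real.sInf_le_sSup _ (bddBelow_inner_image hA u) (bddAbove_inner_image hA u))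

/-- The width of a set containing a homothetic copy of `K` of ratio `r` is at least `r` times the
width of `K`. -/
theorem mul_widthParallel_le {K A : Set (EuclideanSpace ℝ (Fin d))} (hKn : K.Nonempty)
    (hK : IsCompact K) (hA : IsCompact A) {r : ℝ} {x : EuclideanSpace ℝ (Fin d)}
    (h : ∀ b ∈ K, x + r • b ∈ A) (u : EuclideanSpace ℝ (Fin d)) :
    r * widthParallel K u ≤ widthParallel A u := by
  have hf : Continuous fun x : EuclideanSpace ℝ (Fin d) => (inner ℝ u x : ℝ) := by fun_prop
  obtain ⟨p, hp, hp'⟩ := hK.exists_sSup_image_eq hKn hf.continuousOn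
  obtain ⟨q, hq, hq'⟩ := hK.exists_sInf_image_eq hKn hf.continuousOn
  have h1 := le_csSup (bddAbove_inner_image hA u) (mem_image_of_mem _ (h p hp))
  have h2 := csInf_le (bddBelow_inner_image hA u) (mem_image_of_mem _ (h q hq))
  simp only [inner_add_right, inner_smul_right] at h1 h2
  unfold widthParallel
  rw [hp', hq']
  linarith

theorem mul_minimalRelativeWidth_le (hd : 2 ≤ d) {C K A : Set (EuclideanSpace ℝ (Fin d))}
    (hC : IsCompact C) (hKn : K.Nonempty) (hK : IsCompact K) (hA : IsCompact A) {r : ℝ}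
    (hr : 0 ≤ r) {x : EuclideanSpace ℝ (Fin d)} (h : ∀ b ∈ K, x + r • b ∈ A) :
    r * minimalRelativeWidth C K ≤ minimalRelativeWidth C A := by
  -- Unit normals must exist for `le_ciInf` to apply.
  have : Nontrivial (EuclideanSpace ℝ (Fin d)) := by
    have : Nontrivial (Fin d) := Fin.nontrivial_iff_two_le.mpr hd
    infer_instance
  have : Nonempty (Metric.sphere (0 : EuclideanSpace ℝ (Fin d)) 1) :=
    (NormedSpace.sphere_nonempty.mpr zero_le_one).to_subtype
  refine le_ciInf fun u => ?_
  have hbdd : BddBelow (range fun u : Metric.sphere (0 : EuclideanSpace ℝ (Fin d)) 1 =>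
      widthParallel K u / widthParallel C u) :=
    ⟨0, by
      rintro _ ⟨u, rfl⟩
      exact div_nonneg (widthParallel_nonneg hK _) (widthParallel_nonneg hC _)⟩
  calc r * minimalRelativeWidth C K
      ≤ r * (widthParallel K u / widthParallel C u) :=
        mul_le_mul_of_nonneg_left (ciInf_le hbdd u) hr
    _ = r * widthParallel K u / widthParallel C u := by rw [mul_div_assoc]
    _ ≤ widthParallel A u / widthParallel C u :=
        div_le_div_of_nonneg_right (mul_widthParallel_le hKn hK hA h u) (widthParallel_nonneg hC _)

theorem minimalRelativeWidth_nonneg {C A : Set (EuclideanSpace ℝ (Fin d))}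
    (hC : IsCompact C) (hA : IsCompact A) : 0 ≤ minimalRelativeWidth C A :=
  Real.iInf_nonneg fun _ => div_nonneg (widthParallel_nonneg hA _) (widthParallel_nonneg hC _)

end Width

/-! ### The width inequality -/

theorem corollary2p3 {d : ℕ} (hd : 2 ≤ d) (K C : ConvexBody (EuclideanSpace ℝ (Fin d)))
    (hK : (interior (K : Set (EuclideanSpace ℝ (Fin d)))).Nonempty)
    (hC : (interior (C : Set (EuclideanSpace ℝ (Fin d)))).Nonempty)
    {n : ℕ} (V : Fin n → Set (EuclideanSpace ℝ (Fin d))) (hV : IsInductivePartition V)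
    (hVK : ∀ i, (interior (V i ∩ (K : Set (EuclideanSpace ℝ (Fin d))))).Nonempty) :
    minimalRelativeWidth (C : Set (EuclideanSpace ℝ (Fin d))) (K : Set (EuclideanSpace ℝ (Fin d))) ≤
      ∑ i, minimalRelativeWidth (C : Set (EuclideanSpace ℝ (Fin d)))
        (V i ∩ (K : Set (EuclideanSpace ℝ (Fin d)))) := by
  have hsum := hV.one_le_sum_sSup_homothetyRatios K.isCompact K.convex hK 0
  have hw := minimalRelativeWidth_nonneg C.isCompact K.isCompact
  have hcell : ∀ i, sSup (homothetyRatios (K : Set (EuclideanSpace ℝ (Fin d))) (V i) 0) *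
      minimalRelativeWidth (C : Set (EuclideanSpace ℝ (Fin d))) K ≤
      minimalRelativeWidth (C : Set (EuclideanSpace ℝ (Fin d))) (V i ∩ K) := by
    intro i
    have hcpt : IsCompact (V i ∩ (K : Set (EuclideanSpace ℝ (Fin d)))) :=
      K.isCompact.inter_left (hV.isConvexPartition.isClosed i)
    rcases hw.eq_or_lt with h0 | hpos
    · rw [← h0, mul_zero]
      exact minimalRelativeWidth_nonneg C.isCompact hcpt
    -- As a bound on the supremum itself, it suffices to check each ratio; no largest copy is
    -- needed.
    rw [← le_div_iff₀ hpos]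
    obtain ⟨z, hz⟩ := (hVK i).mono interior_subset
    refine csSup_le ⟨0, zero_mem_homothetyRatios hz.1 (by simpa using hz.2)⟩ ?_
    rintro r ⟨hr, -, x, hx⟩
    rw [le_div_iff₀ hpos]
    exact mul_minimalRelativeWidth_le hd C.isCompact K.nonempty K.isCompact hcpt hr
      fun b hb => ⟨(hx b hb).1, by simpa using (hx b hb).2⟩
  calc minimalRelativeWidth (C : Set (EuclideanSpace ℝ (Fin d))) K
      ≤ (∑ i, sSup (homothetyRatios (K : Set (EuclideanSpace ℝ (Fin d))) (V i) 0)) *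
          minimalRelativeWidth (C : Set (EuclideanSpace ℝ (Fin d))) K :=
        le_mul_of_one_le_left hw hsum
    _ = ∑ i, sSup (homothetyRatios (K : Set (EuclideanSpace ℝ (Fin d))) (V i) 0) *
          minimalRelativeWidth (C : Set (EuclideanSpace ℝ (Fin d))) K := Finset.sum_mul ..
    _ ≤ _ := Finset.sum_le_sum fun i _ => hcell i
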